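/- All graphs are finite and loopless but may have parallel edges (of equal or of different colours). A 2-edge-coloured graph is such a graph $G=(V,E)$ together with a map $\phi:E\to\{1,2\}$. A walk is alternating if any two consecutive edges have different colours; for a closed alternating walk the last and the first edge must also have different colours. A trail is a walk without repeated edges. A 2-edge-coloured graph $G$ is - M-closed if $x$ and $z$ are adjacent whenever $x\neq z$ and some vertex $y$ is joined to $x$ and to $z$ by edges of the same colour; - supereulerian if it has a closed alternating trail with at least one edge that visits every vertex; - trail-colour-connected if for every two distinct vertices $u,v$ there are two alternating $(u,v)$-trails $T_1,T_2$ such that $T_1$ followed by the reverse of $T_2$ is an alternating closed walk. An eulerian factor of $G$ is a collection of pairwise vertex-disjoint induced subgraphs of $G$ that cover all vertices of $G$ and each of which is supereulerian. An extension of a 2-edge-coloured graph $G_0$ with vertices $v_1,\dots,v_n$, $n>1$, is a graph obtained from $G_0$ by replacing each vertex $v_i$ by an independent set $I_i$ of $p_i\ge 1$ vertices and each edge of colour $c$ between $v_i$ and $v_j$ by edges of colour $c$, one between each vertex of $I_i$ and each vertex of $I_j$. **Theorem.** Let $G$ be an extension of an M-closed 2-edge-coloured graph with more than one vertex. Then $G$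 is supereulerian if and only if $G$ is trail-colour-connected and has an eulerian factor. -/

import Mathlib

open scoped Graph

/-
A `2`-edge-coloured multigraph is a multigraph `G : Graph α β` together with a map
`φ : β → Fin 2` on edge labels, of which only the values on the edges of `G` matter.
-/

namespace Graph

variable {α β : Type*}

/-- `G.IsWalkFrom x w y`: starting at the vertex `x` and successively using, for each entry `(e, z)`
of the list `w`, the edge `e` to go to the vertex `z`, is a walk of `G` that ends at `y`. -/
def IsWalkFrom (G : Graph α β) : α → List (β × α) → α → Prop
  | x, [], y => x ∈ V(G) ∧ x = y
  | x, (e, z) :: w, y => G.IsLink e x z ∧ G.IsWalkFrom z w y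

/-- The sequence of edges used by a walk. -/
def walkEdges (w : List (β × α)) : List β := w.map Prod.fst

/-- Consecutive edges of the sequence have different colours. -/
def IsAlternating (φ : β → Fin 2) (es : List β) : Prop :=
  es.IsChain (fun e f => φ e ≠ φ f)

/-- Cyclically consecutive edges have different colours; in particular so have the last edge
and the first one. -/
def IsCyclicallyAlternating (φ : β → Fin 2) (es : List β) : Prop :=
  (es : Cycle β).Chain (fun e f => φ e ≠ φ f)

/-- An alternating `(x, y)`-trail: an alternating walk that repeats no edge. -/
def IsAlternatingTrail (G : Graph α β) (φ : β → Fin 2) (x : α) (w : List (β × α)) (y : α) : Prop :=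
  G.IsWalkFrom x w y ∧ (walkEdges w).Nodup ∧ IsAlternating φ (walkEdges w)

/-- A closed alternating trail with at least one edge. -/
def IsClosedAlternatingTrail (G : Graph α β) (φ : β → Fin 2) (x : α) (w : List (β × α)) : Prop :=
  w ≠ [] ∧ G.IsWalkFrom x w x ∧ (walkEdges w).Nodup ∧ IsCyclicallyAlternating φ (walkEdges w)

/-- There is a closed alternating trail through all the vertices. -/
def IsSupereulerian (G : Graph α β) (φ : β → Fin 2) : Prop :=
  ∃ (x : α) (w : List (β × α)), G.IsClosedAlternatingTrail φ x w ∧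
    ∀ v ∈ V(G), v ∈ w.map Prod.snd

/-- For all distinct vertices `u, v` there are alternating `(u, v)`-trails `T₁, T₂` such that
`T₁` followed by the reverse of `T₂` is an alternating closed walk. -/
def IsTrailColourConnected (G : Graph α β) (φ : β → Fin 2) : Prop :=
  ∀ u ∈ V(G), ∀ v ∈ V(G), u ≠ v → ∃ T₁ T₂ : List (β × α),
    G.IsAlternatingTrail φ u T₁ v ∧ G.IsAlternatingTrail φ u T₂ v ∧
    IsCyclicallyAlternating φ (walkEdges T₁ ++ (walkEdges T₂).reverse)

/-- Vertex-disjoint induced subgraphs that cover all the vertices, each of them supereulerian. -/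
def HasEulerianFactor (G : Graph α β) (φ : β → Fin 2) : Prop :=
  ∃ (k : ℕ) (W : Fin k → Set α), Pairwise (fun i j => Disjoint (W i) (W j)) ∧
    (⋃ i, W i) = V(G) ∧ ∀ i, (G.induce (W i)).IsSupereulerian φ

/-- The ends of every monochromatic path `x y z` of length two are adjacent. -/
def IsMClosed (G : Graph α β) (φ : β → Fin 2) : Prop :=
  ∀ ⦃e f : β⦄ ⦃x y z : α⦄, G.IsLink e x y → G.IsLink f y z → x ≠ z → φ e = φ f → G.Adj x z

/-- The graph obtained from a loopless graph `G` by replacing each vertex `v` by the independent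
set of the `p v` vertices `(v, 0), …, (v, p v - 1)`, and each edge `e` between `x` and `y` by one
edge, labelled `(e, s(a, b))`, between `a` and `b` for all copies `a` of `x` and `b` of `y`. -/
def extension (G : Graph α β) (p : α → ℕ) : Graph (α × ℕ) (β × Sym2 (α × ℕ)) where
  vertexSet := {a | a.1 ∈ V(G) ∧ a.2 < p a.1}
  IsLink d a b := G.IsLink d.1 a.1 b.1 ∧ a.2 < p a.1 ∧ b.2 < p b.1 ∧ d.2 = s(a, b)
  isLink_symm := by
    intro d _
    exact ⟨fun a b ⟨h, ha, hb, hd⟩ => ⟨h.symm, hb, ha, hd.trans Sym2.eq_swap⟩⟩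
  eq_or_eq_of_isLink_of_isLink := by
    rintro d a b a' b' ⟨_, _, _, h⟩ ⟨_, _, _, h'⟩
    rcases Sym2.eq_iff.1 (h.symm.trans h') with h | h
    · exact Or.inl h.1
    · exact Or.inr h.1
  left_mem_of_isLink := by
    rintro d a b ⟨h, ha, _, _⟩
    exact ⟨h.left_mem, ha⟩

/-- Each edge of an extension inherits the colour of the edge that it is a copy of. -/
def extensionColour (φ : β → Fin 2) : β × Sym2 (α × ℕ) → Fin 2 :=
  fun d => φ d.1

end Graph

/-!
Call a finite set `F` of edges *balanced* if at every vertex it has equally many edges of either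
colour. A connected balanced set is the edge set of a closed alternating trail, so an eulerian
factor amounts to a balanced set of edges that covers all vertices. Choose such a set `F` for which
connectedness through `F` is a maximal relation on the vertices, and suppose that `F` is not
connected.

By maximality, exchanges that keep `F` balanced and merge components are impossible. Hence there
are no alternating cycles of edges between components, and for edges `x x'` and `y y'` of `F` of the
same colour `c` in different components, `x y` and `x' y'` are not both joined by colour `c`. In an
M-closed graph this makes the signs of the colours between `{x, x'}` and `{y, y'}` sum to at most
zero (times the sign of `c`). As `F` is balanced, all these sums together vanish; hence each one of
them does, adjacent components are completely joined, and the colour changes whenever one moves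
along two edges of `F` of the same colour.

The absence of alternating 4-cycles now orients each adjacent pair of components: one of them
*dominates* the other, in that the colour of an edge between them depends only on its end in the
former. The absence of alternating 6-cycles makes this relation a strict partial order. In a
component that no other one dominates, all edges that leave the component from a given vertex `a`
have one colour, and an alternating walk that comes from outside can only arrive at `a` by that
colour. Two trails from a vertex outside to `a` that arrive by different colours are therefore
impossible, which contradicts trail-colour-connectedness.
-/

namespace EdgeColouredGraph

open Graph

variable {α β : Type*} {G H : Graph α β} {φ : β → Fin 2} {c c' d : Fin 2} {x y z u v x' y' : α}
  {w w' : List (β × α)} {e f : β} {F A : Finset β}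

/-! ### Colours -/

lemma colour_add_one_add_one (c : Fin 2) : c + 1 + 1 = c := by
  decide +revert

lemma colour_add_one_ne (c : Fin 2) : c + 1 ≠ c := by
  decide +revert

lemma colour_ne_iff : c ≠ d ↔ d = c + 1 := by
  decide +revert

/-- The sign `1` or `-1` of a colour, by which edges are weighted when the two colours at a vertex
are balanced against each other. -/
def sgn (c : Fin 2) : ℤ := if c = 0 then 1 else -1

lemma sgn_add_one (c : Fin 2) : sgn (c + 1) = -sgn c := by
  decide +revert

lemma sgn_eq_one_or_eq_neg_one (c : Fin 2) : sgn c = 1 ∨ sgn c = -1 := by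
  decide +revert

lemma sgn_mul_self (c : Fin 2) : sgn c * sgn c = 1 := by
  decide +revert

/-! ### Alternating walks -/

/-- `AltWalk G φ c x w y d`: the list `w` is an alternating walk from `x` to `y` whose first edge
has colour `c`, and which is continued alternatingly by edges of colour `d`. So `c = d` if `w` is
empty, and a walk from `x` to `x` is a closed alternating walk if and only if `c = d`. -/
inductive AltWalk (G : Graph α β) (φ : β → Fin 2) :
    Fin 2 → α → List (β × α) → α → Fin 2 → Prop
  | nil {c : Fin 2} {x : α} (hx : x ∈ V(G)) : AltWalk G φ c x [] x c
  | cons {c d : Fin 2} {e : β} {x y z : α} {w : List (β × α)} (hl : G.IsLink e x z) (he : φ e = c)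
      (hw : AltWalk G φ (c + 1) z w y d) : AltWalk G φ c x ((e, z) :: w) y d

@[simp]
lemma walkEdges_nil : walkEdges ([] : List (β × α)) = [] :=
  rfl

@[simp]
lemma walkEdges_cons (a : β × α) (w : List (β × α)) : walkEdges (a :: w) = a.1 :: walkEdges w :=
  rfl

@[simp]
lemma walkEdges_append (w w' : List (β × α)) :
    walkEdges (w ++ w') = walkEdges w ++ walkEdges w' :=
  List.map_append

namespace AltWalk

lemma single (hl : G.IsLink e x y) (he : φ e = c) : AltWalk G φ c x [(e, y)] y (c + 1) :=
  cons hl he (nil hl.right_mem)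

lemma left_mem (h : AltWalk G φ c x w y d) : x ∈ V(G) := by
  cases h with
  | nil hx => exact hx
  | cons hl => exact hl.left_mem

lemma append (h : AltWalk G φ c x w y d) (h' : AltWalk G φ d y w' z c') :
    AltWalk G φ c x (w ++ w') z c' := by
  induction h with
  | nil => exact h'
  | cons hl he _ ih => exact cons hl he (ih h')

lemma edge_mem (h : AltWalk G φ c x w y d) (he : e ∈ walkEdges w) : e ∈ E(G) := by
  induction h with
  | nil => simp at he
  | cons hl _ _ ih =>
    rcases List.mem_cons.1 he with rfl | he
    · exact hl.edge_mem
    · exact ih he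

lemma exists_split (h : AltWalk G φ c x w y d) (hv : v ∈ w.map Prod.snd) :
    ∃ w₁ w₂ c', w = w₁ ++ w₂ ∧ AltWalk G φ c x w₁ v c' ∧ AltWalk G φ c' v w₂ y d := by
  induction h with
  | nil => simp at hv
  | @cons c d e x y z w hl he hw ih =>
    rcases List.mem_cons.1 hv with rfl | hv
    · exact ⟨[(e, v)], w, c + 1, rfl, single hl he, hw⟩
    · obtain ⟨w₁, w₂, c', rfl, h₁, h₂⟩ := ih hv
      exact ⟨(e, z) :: w₁, w₂, c', rfl, cons hl he h₁, h₂⟩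

lemma exists_rotation (h : AltWalk G φ c x w x c) (hv : v ∈ w.map Prod.snd) :
    ∃ w' d, w'.Perm w ∧ AltWalk G φ d v w' v d := by
  obtain ⟨w₁, w₂, d, rfl, h₁, h₂⟩ := h.exists_split hv
  exact ⟨w₂ ++ w₁, d, List.perm_append_comm, h₂.append h₁⟩

lemma exists_reverse (h : AltWalk G φ c x w y d) :
    ∃ w', AltWalk G φ (d + 1) y w' x (c + 1) ∧ walkEdges w' = (walkEdges w).reverse := by
  induction h with
  | nil hx => exact ⟨[], nil hx, rfl⟩
  | @cons c d e x y z w hl he _ ih =>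
    obtain ⟨w', hw', hrev⟩ := ih
    rw [colour_add_one_add_one] at hw'
    exact ⟨w' ++ [(e, x)], hw'.append (single hl.symm he), by simp [hrev]⟩

lemma isWalkFrom (h : AltWalk G φ c x w y d) : G.IsWalkFrom x w y := by
  induction h with
  | nil hx => exact ⟨hx, rfl⟩
  | cons hl _ _ ih => exact ⟨hl, ih⟩

lemma colour_head (h : AltWalk G φ c x w y d) : ∀ e ∈ (walkEdges w).head?, φ e = c := by
  cases h with
  | nil => simp
  | cons _ he => simpa using he

lemma isAlternating (h : AltWalk G φ c x w y d) : IsAlternating φ (walkEdges w) := by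
  induction h with
  | nil => exact List.isChain_nil
  | cons _ he hw ih =>
    refine List.isChain_cons.2 ⟨fun f hf => ?_, ih⟩
    rw [he, hw.colour_head f hf]
    exact (colour_add_one_ne _).symm

lemma isCyclicallyAlternating (h : AltWalk G φ c x w x c) :
    IsCyclicallyAlternating φ (walkEdges w) := by
  cases h with
  | nil => exact Cycle.Chain.nil _
  | cons hl he hw =>
    have := ((cons hl he hw).append (single hl he)).isAlternating
    rw [walkEdges_append] at this
    exact (Cycle.chain_coe_cons _ _ _).2 this

lemma right_mem_map_snd (h : AltWalk G φ c x w y d) (hw : w ≠ []) : y ∈ w.map Prod.snd := by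
  induction h with
  | nil => exact absurd rfl hw
  | cons _ _ htail ih =>
    cases htail with
    | nil => simp
    | cons => exact List.mem_cons_of_mem _ (ih (List.cons_ne_nil _ _))

lemma eq_or_mem_of_inc (h : AltWalk G φ c x w y d) (he : e ∈ walkEdges w) (hi : G.Inc e v) :
    v = x ∨ v ∈ w.map Prod.snd := by
  induction h with
  | nil => simp at he
  | cons hl _ _ ih =>
    rw [List.map_cons, List.mem_cons]
    rcases List.mem_cons.1 he with rfl | he
    · exact (hi.eq_or_eq_of_isLink hl).imp_right Or.inl
    · exact Or.inr (ih he)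

lemma exists_mem_walkEdges_inc (h : AltWalk G φ c x w y d) (hv : v ∈ w.map Prod.snd) :
    ∃ e ∈ walkEdges w, G.Inc e v := by
  induction h with
  | nil => simp at hv
  | @cons c d e x y z w hl _ _ ih =>
    rcases List.mem_cons.1 hv with rfl | hv
    · exact ⟨e, List.mem_cons_self, hl.inc_right⟩
    · obtain ⟨f, hf, hi⟩ := ih hv
      exact ⟨f, List.mem_cons_of_mem _ hf, hi⟩

end AltWalk

lemma altWalk_of_isWalkFrom (hw : G.IsWalkFrom x w y)
    (ha : IsAlternating φ (walkEdges w ++ [e])) (hc : ∀ f ∈ (walkEdges w ++ [e]).head?, φ f = c) :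
    AltWalk G φ c x w y (φ e) := by
  induction w generalizing c x with
  | nil =>
    obtain ⟨hx, rfl⟩ := hw
    obtain rfl := hc e rfl
    exact .nil hx
  | cons a w ih =>
    obtain rfl := hc a.1 rfl
    obtain ⟨hhead, ha⟩ := List.isChain_cons.1 ha
    exact .cons hw.1 rfl (ih hw.2 ha fun f hf => colour_ne_iff.1 (hhead f hf))

lemma exists_altWalk_of_isClosedAlternatingTrail (h : G.IsClosedAlternatingTrail φ x w) :
    ∃ c, AltWalk G φ c x w x c := by
  obtain ⟨hne, hw, -, hcyc⟩ := h
  obtain ⟨a, w, rfl⟩ := List.exists_cons_of_ne_nil hne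
  have hchain : IsAlternating φ (walkEdges (a :: w) ++ [a.1]) := (Cycle.chain_coe_cons _ _ _).1 hcyc
  exact ⟨φ a.1, altWalk_of_isWalkFrom hw hchain (by simp)⟩

lemma isAlternating_of_isCyclicallyAlternating {es : List β}
    (h : IsCyclicallyAlternating φ es) : IsAlternating φ es := by
  cases es with
  | nil => exact List.isChain_nil
  | cons e es => exact List.IsChain.left_of_append (l₂ := [e]) ((Cycle.chain_coe_cons _ _ _).1 h)

lemma exists_altWalk_pair_of_isTrailColourConnected (h : G.IsTrailColourConnected φ)
    (hu : u ∈ V(G)) (hv : v ∈ V(G)) (hne : u ≠ v) :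
    ∃ c c' d w w', AltWalk G φ c u w v d ∧ AltWalk G φ c' u w' v (d + 1) := by
  have exists_last {T : List (β × α)} (hT : G.IsWalkFrom u T v) :
      ∃ es e, walkEdges T = es ++ [e] := by
    rcases List.eq_nil_or_concat' (walkEdges T) with hnil | h
    · obtain rfl := List.map_eq_nil_iff.1 hnil
      exact absurd hT.2 hne
    · exact h
  have exists_colour (es : List β) (e : β) : ∃ c, ∀ f ∈ (es ++ [e]).head?, φ f = c := by
    cases es <;> simp
  obtain ⟨T₁, T₂, ⟨hT₁, -, -⟩, ⟨hT₂, -, -⟩, hcyc⟩ := h u hu v hv hne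
  obtain ⟨es₁, e₁, h₁⟩ := exists_last hT₁
  obtain ⟨es₂, e₂, h₂⟩ := exists_last hT₂
  have hchain : IsAlternating φ (es₁ ++ [e₁] ++ e₂ :: es₂.reverse) := by
    simpa [h₁, h₂] using isAlternating_of_isCyclicallyAlternating hcyc
  have hchain₁ : IsAlternating φ (walkEdges T₁ ++ [e₂]) :=
    h₁ ▸ (List.isChain_split.1 hchain).1
  obtain ⟨hlast, hchain₂⟩ : φ e₁ ≠ φ e₂ ∧ IsAlternating φ (walkEdges T₂ ++ [e₁]) := by
    rw [IsAlternating, List.append_assoc, List.singleton_append, List.isChain_split] at hchain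
    refine ⟨(List.isChain_cons_cons.1 hchain.2).1, ?_⟩
    have := List.isChain_reverse.2 (hchain.2.imp fun _ _ h => h.symm)
    simpa [h₂, IsAlternating] using this
  obtain ⟨c, hc⟩ := exists_colour (walkEdges T₁) e₂
  obtain ⟨c', hc'⟩ := exists_colour (walkEdges T₂) e₁
  exact ⟨c, c', _, T₁, T₂, altWalk_of_isWalkFrom hT₁ hchain₁ hc,
    colour_ne_iff.1 hlast.symm ▸ altWalk_of_isWalkFrom hT₂ hchain₂ hc'⟩

lemma isTrailColourConnected_of_isSupereulerian (h : G.IsSupereulerian φ) :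
    G.IsTrailColourConnected φ := by
  intro u hu v hv _
  obtain ⟨x, w, htrail, hspan⟩ := h
  obtain ⟨c, hw⟩ := exists_altWalk_of_isClosedAlternatingTrail htrail
  obtain ⟨w, c, hperm, hw⟩ := hw.exists_rotation (hspan u hu)
  have hnodup : (walkEdges w).Nodup := (hperm.map Prod.fst).nodup_iff.2 htrail.2.2.1
  obtain ⟨T₁, w₂, d, rfl, hT₁, hw₂⟩ :=
    hw.exists_split ((hperm.map Prod.snd).mem_iff.2 (hspan v hv))
  obtain ⟨T₂, hT₂, hrev⟩ := hw₂.exists_reverse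
  rw [walkEdges_append, List.nodup_append] at hnodup
  refine ⟨T₁, T₂, ⟨hT₁.isWalkFrom, hnodup.1, hT₁.isAlternating⟩,
    ⟨hT₂.isWalkFrom, hrev ▸ List.nodup_reverse.2 hnodup.2.1, hT₂.isAlternating⟩, ?_⟩
  rw [hrev, List.reverse_reverse, ← walkEdges_append]
  exact hw.isCyclicallyAlternating

lemma hasEulerianFactor_of_isSupereulerian (h : G.IsSupereulerian φ) : G.HasEulerianFactor φ :=
  ⟨1, fun _ => V(G), fun i j hij => absurd (Subsingleton.elim i j) hij, Set.iUnion_const _,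
    fun _ => (Graph.induce_vertexSet (G := G)).symm ▸ h⟩

/-! ### Balanced sets of edges -/

open scoped Classical in
/-- The incidence indicator of the edge `e` and the vertex `v`. -/
noncomputable def incInd (G : Graph α β) (e : β) (v : α) : ℤ := if G.Inc e v then 1 else 0

open scoped Classical in
lemma incInd_eq_add [G.Loopless] (h : G.IsLink e x y) (v : α) :
    incInd G e v = (if v = x then 1 else 0) + (if v = y then 1 else 0) := by
  have hinc : G.Inc e v ↔ v = x ∨ v = y :=
    ⟨fun hi => hi.eq_or_eq_of_isLink h, by rintro (rfl | rfl); exacts [h.inc_left, h.inc_right]⟩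
  by_cases hx : v = x
  · simp [incInd, hx, h.ne, h.inc_left]
  · simp [incInd, hinc, hx]

lemma incInd_of_le (hle : H ≤ G) (he : e ∈ E(H)) (v : α) : incInd H e v = incInd G e v := by
  classical
  exact if_congr (hle.inc_congr he) rfl rfl

/-- The balance of `F` at `v`: the number of edges of colour `0` minus the number of edges of
colour `1` in `F` at `v`. -/
noncomputable def bal (G : Graph α β) (φ : β → Fin 2) (F : Finset β) (v : α) : ℤ :=
  ∑ e ∈ F, sgn (φ e) * incInd G e v

open scoped Classical in
lemma bal_union_of_disjoint (h : Disjoint F A) (v : α) :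
    bal G φ (F ∪ A) v = bal G φ F v + bal G φ A v :=
  Finset.sum_union h

open scoped Classical in
lemma bal_sdiff (h : A ⊆ F) (v : α) : bal G φ (F \ A) v = bal G φ F v - bal G φ A v :=
  Finset.sum_sdiff_eq_sub h

lemma bal_singleton (e : β) (v : α) : bal G φ {e} v = sgn (φ e) * incInd G e v :=
  Finset.sum_singleton _ _

lemma bal_of_le (hle : H ≤ G) (hF : ∀ e ∈ F, e ∈ E(H)) (v : α) : bal H φ F v = bal G φ F v :=
  Finset.sum_congr rfl fun e he => by rw [incInd_of_le hle (hF e he)]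

open scoped Classical in
lemma AltWalk.bal_walkEdges [G.Loopless] (h : AltWalk G φ c x w y d) (hw : (walkEdges w).Nodup)
    (v : α) : bal G φ (walkEdges w).toFinset v =
      sgn c * (if v = x then 1 else 0) - sgn d * (if v = y then 1 else 0) := by
  induction h with
  | nil => simp [bal]
  | cons hl he _ ih =>
    rw [walkEdges_cons, List.nodup_cons] at hw
    have := ih hw.2
    rw [bal] at this
    rw [walkEdges_cons, List.toFinset_cons, bal, Finset.sum_insert (by simpa using hw.1), this,
      incInd_eq_add hl, he, sgn_add_one]
    ring

lemma exists_inc_of_sgn_mul_bal_pos (h : 0 < sgn c * bal G φ F v) :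
    ∃ e ∈ F, φ e = c ∧ G.Inc e v := by
  rw [bal, Finset.mul_sum] at h
  obtain ⟨e, he, hpos⟩ := Finset.exists_lt_of_sum_lt (f := fun _ => (0 : ℤ)) (by simpa using h)
  have hi : G.Inc e v := by
    by_contra hi
    simp [incInd, hi] at hpos
  refine ⟨e, he, ?_, hi⟩
  by_contra hc
  rw [colour_ne_iff.1 (Ne.symm hc), sgn_add_one] at hpos
  have := sgn_mul_self c
  simp only [incInd, hi, if_true] at hpos
  linarith

lemma exists_inc_of_bal_eq_zero (h : bal G φ F v = 0) (he : e ∈ F) (hi : G.Inc e v) (c : Fin 2) :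
    ∃ e ∈ F, φ e = c ∧ G.Inc e v := by
  classical
  by_cases hc : φ e = c
  · exact ⟨e, he, hc, hi⟩
  have hpos : 0 < sgn c * bal G φ (F \ {e}) v := by
    have := sgn_mul_self c
    simp only [bal_sdiff (Finset.singleton_subset_iff.2 he), h, bal_singleton, incInd, hi, if_true,
      colour_ne_iff.1 (Ne.symm hc), sgn_add_one]
    linarith
  obtain ⟨e', he', hinc⟩ := exists_inc_of_sgn_mul_bal_pos hpos
  exact ⟨e', (Finset.mem_sdiff.1 he').1, hinc⟩

/-! ### Alternating trails in balanced sets of edges -/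

/-- An alternating walk, with colours as in `AltWalk`, that uses edges of `F` only and none of them
twice. -/
structure IsTrailIn (G : Graph α β) (φ : β → Fin 2) (F : Finset β) (c : Fin 2) (x : α)
    (w : List (β × α)) (y : α) (d : Fin 2) : Prop where
  altWalk : AltWalk G φ c x w y d
  nodup : (walkEdges w).Nodup
  mem : ∀ e ∈ walkEdges w, e ∈ F

namespace IsTrailIn

open scoped Classical in
lemma append (h : IsTrailIn G φ F c x w y d)
    (h' : IsTrailIn G φ (F \ (walkEdges w).toFinset) d y w' z c') :
    IsTrailIn G φ F c x (w ++ w') z c' where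
  altWalk := h.altWalk.append h'.altWalk
  nodup := by
    rw [walkEdges_append]
    refine h.nodup.append h'.nodup fun e he he' => ?_
    simpa [he] using h'.mem e he'
  mem e he := by
    rw [walkEdges_append, List.mem_append] at he
    exact he.elim (h.mem e) fun he => (Finset.mem_sdiff.1 (h'.mem e he)).1

open scoped Classical in
lemma cons (he : e ∈ F) (hl : G.IsLink e x z) (h : IsTrailIn G φ (F \ {e}) (φ e + 1) z w y d) :
    IsTrailIn G φ F (φ e) x ((e, z) :: w) y d :=
  append (w := [(e, z)]) ⟨.single hl rfl, by simp, by simpa using he⟩ (by simpa using h)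

lemma length_le (h : IsTrailIn G φ F c x w y d) : w.length ≤ F.card := by
  classical
  calc w.length = (walkEdges w).toFinset.card := by
        rw [List.toFinset_card_of_nodup h.nodup, walkEdges, List.length_map]
    _ ≤ F.card := Finset.card_le_card fun e he => h.mem e (List.mem_toFinset.1 he)

end IsTrailIn

open scoped Classical in
lemma exists_isTrailIn [G.Loopless] (hx : x ∈ V(G))
    (hF : ∀ v, bal G φ F v = sgn c * (if v = x then 1 else 0) - sgn d * (if v = y then 1 else 0)) :
    ∃ w, IsTrailIn G φ F c x w y d := by
  induction F using Finset.strongInduction generalizing c x with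
  | H F ih =>
    by_cases hend : x = y ∧ c = d
    · obtain ⟨rfl, rfl⟩ := hend
      exact ⟨[], .nil hx, by simp, by simp⟩
    have hpos : 0 < sgn c * bal G φ F x := by
      have := sgn_mul_self c
      rw [hF]
      by_cases hxy : x = y
      · rw [colour_ne_iff.1 fun h => hend ⟨hxy, h⟩, sgn_add_one, if_pos rfl, if_pos hxy]
        linarith
      · rw [if_pos rfl, if_neg hxy]
        linarith
    obtain ⟨e, he, rfl, z, hl⟩ := exists_inc_of_sgn_mul_bal_pos hpos
    obtain ⟨w, hw⟩ := ih (F \ {e}) (Finset.sdiff_ssubset (by simpa using he) (by simp))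
      (c := φ e + 1) hl.right_mem fun v => by
        rw [bal_sdiff (by simpa using he), bal_singleton, incInd_eq_add hl, hF, sgn_add_one]
        ring
    exact ⟨_, hw.cons he hl⟩

open scoped Classical in
lemma exists_isTrailIn_sdiff_singleton [G.Loopless] (hF : ∀ v, bal G φ F v = 0) (he : e ∈ F)
    (hl : G.IsLink e x y) : ∃ w, IsTrailIn G φ (F \ {e}) (φ e + 1) y w x (φ e) :=
  exists_isTrailIn hl.right_mem fun v => by
    rw [bal_sdiff (by simpa using he), bal_singleton, incInd_eq_add hl, hF, sgn_add_one]
    ring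

lemma exists_closed_isTrailIn [G.Loopless] (hF : ∀ v, bal G φ F v = 0) (he : e ∈ F)
    (hi : G.Inc e x) : ∃ w ≠ [], IsTrailIn G φ F (φ e) x w x (φ e) := by
  obtain ⟨z, hl⟩ := hi
  obtain ⟨w, hw⟩ := exists_isTrailIn_sdiff_singleton hF he hl
  exact ⟨_, List.cons_ne_nil _ _, hw.cons he hl⟩

/-! ### Connectedness through a set of edges -/

/-- The vertices `x` and `y` are joined by a walk all of whose edges are in `F`. -/
def Conn (G : Graph α β) (F : Finset β) : α → α → Prop :=
  Relation.ReflTransGen fun x y => ∃ e ∈ F, G.IsLink e x y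

namespace Conn

lemma refl (x : α) : Conn G F x x :=
  Relation.ReflTransGen.refl

lemma trans (h : Conn G F x y) (h' : Conn G F y z) : Conn G F x z :=
  Relation.ReflTransGen.trans h h'

lemma symm (h : Conn G F x y) : Conn G F y x :=
  have : Std.Symm fun x y => ∃ e ∈ F, G.IsLink e x y := ⟨fun _ _ ⟨e, he, hl⟩ => ⟨e, he, hl.symm⟩⟩
  Std.Symm.symm (r := Relation.ReflTransGen _) _ _ h

lemma of_isLink (he : e ∈ F) (h : G.IsLink e x y) : Conn G F x y :=
  .single ⟨e, he, h⟩

lemma of_forall_isLink (hF : ∀ e ∈ F, ∀ x y, G.IsLink e x y → Conn G A x y)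
    (h : Conn G F x y) : Conn G A x y := by
  induction h with
  | refl => exact .refl _
  | tail _ h ih =>
    obtain ⟨e, he, hl⟩ := h
    exact ih.trans (hF e he _ _ hl)

lemma eq_or_mem (h : Conn G F x y) : x = y ∨ x ∈ V(G) ∧ y ∈ V(G) := by
  induction h with
  | refl => exact Or.inl rfl
  | tail _ h ih =>
    obtain ⟨e, -, hl⟩ := h
    refine Or.inr ⟨?_, hl.right_mem⟩
    rcases ih with rfl | ih
    exacts [hl.left_mem, ih.1]

lemma right_mem (h : Conn G F x y) (hx : x ∈ V(G)) : y ∈ V(G) :=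
  h.eq_or_mem.elim (fun hxy => hxy ▸ hx) And.right

lemma exists_isLink_leaving {S : Set α} (h : Conn G F x y) (hx : x ∈ S) (hy : y ∉ S) :
    ∃ e ∈ F, ∃ u ∈ S, ∃ v ∉ S, G.IsLink e u v := by
  induction h with
  | refl => exact absurd hx hy
  | @tail b c _ h ih =>
    obtain ⟨e, he, hl⟩ := h
    by_cases hb : b ∈ S
    · exact ⟨e, he, b, hb, c, hy, hl⟩
    · exact ih hb

end Conn

/-! ### Balanced covers -/

/-- A balanced cover: a finite set of edges of `G` that has as many edges of colour `0` as of
colour `1` at every vertex, and at least one edge at every vertex. The edges of the closed trails of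
an eulerian factor form such a set, and conversely each component of a balanced cover is the edge
set of a closed alternating trail. -/
structure IsBalancedCover (G : Graph α β) (φ : β → Fin 2) (F : Finset β) : Prop where
  mem_edgeSet : ∀ e ∈ F, e ∈ E(G)
  bal_eq_zero : ∀ v, bal G φ F v = 0
  exists_inc : ∀ v ∈ V(G), ∃ e ∈ F, G.Inc e v

namespace IsBalancedCover

lemma exists_isLink (hF : IsBalancedCover G φ F) (hv : v ∈ V(G)) (c : Fin 2) :
    ∃ e ∈ F, φ e = c ∧ ∃ u, G.IsLink e v u := by
  obtain ⟨e, he, hi⟩ := hF.exists_inc v hv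
  exact exists_inc_of_bal_eq_zero (hF.bal_eq_zero v) he hi c

lemma finite_vertexSet (hF : IsBalancedCover G φ F) : V(G).Finite := by
  have hfin (e : β) : {v | G.Inc e v}.Finite := by
    by_cases he : e ∈ E(G)
    · obtain ⟨x, y, hl⟩ := Graph.exists_isLink_of_mem_edgeSet he
      exact (Set.toFinite {x, y}).subset fun v hv => hv.eq_or_eq_of_isLink hl
    · simp [he]
  refine (F.finite_toSet.biUnion fun e _ => hfin e).subset fun v hv => ?_
  simpa using hF.exists_inc v hv

lemma exists_longer_isTrailIn [G.Loopless] (hF : IsBalancedCover G φ F)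
    (hw : IsTrailIn G φ F c x w x c) (hu : u ∈ w.map Prod.snd) (he : e ∈ F)
    (hew : e ∉ walkEdges w) (hi : G.Inc e u) :
    ∃ d w', IsTrailIn G φ F d u w' u d ∧ w.length < w'.length := by
  classical
  obtain ⟨w₁, d, hperm, hw₁⟩ := hw.altWalk.exists_rotation hu
  have hpermE : (walkEdges w₁).Perm (walkEdges w) := hperm.map Prod.fst
  have htrail : IsTrailIn G φ F d u w₁ u d :=
    ⟨hw₁, hpermE.nodup_iff.2 hw.nodup, fun a ha => hw.mem a (hpermE.mem_iff.1 ha)⟩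
  have hbal (v : α) : bal G φ (F \ (walkEdges w₁).toFinset) v = 0 := by
    rw [bal_sdiff fun a ha => htrail.mem a (List.mem_toFinset.1 ha), hF.bal_eq_zero,
      hw₁.bal_walkEdges htrail.nodup, sub_self, sub_self]
  obtain ⟨e', he', rfl, hi'⟩ :=
    exists_inc_of_bal_eq_zero (hbal u) (e := e) (by simp [he, hew, hpermE.mem_iff]) hi d
  obtain ⟨w₂, hne, hw₂⟩ := exists_closed_isTrailIn hbal he' hi'
  refine ⟨_, w₁ ++ w₂, htrail.append hw₂, ?_⟩
  rw [List.length_append, hperm.length_eq]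
  exact Nat.lt_add_of_pos_right (List.length_pos_of_ne_nil hne)

lemma isSupereulerian [G.Loopless] (hF : IsBalancedCover G φ F) (hne : V(G).Nonempty)
    (hconn : ∀ u ∈ V(G), ∀ v ∈ V(G), Conn G F u v) : G.IsSupereulerian φ := by
  let closedTrails : Set (List (β × α)) := {w | w ≠ [] ∧ ∃ c x, IsTrailIn G φ F c x w x c}
  obtain ⟨a, ha⟩ := hne
  have hnonempty : closedTrails.Nonempty := by
    obtain ⟨e, he, hi⟩ := hF.exists_inc a ha
    obtain ⟨w, hw, htrail⟩ := exists_closed_isTrailIn hF.bal_eq_zero he hi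
    exact ⟨w, hw, _, _, htrail⟩
  have hfinite : (List.length '' closedTrails).Finite :=
    (Set.finite_Iic F.card).subset (by rintro _ ⟨w, ⟨-, c, x, hw⟩, rfl⟩; exact hw.length_le)
  obtain ⟨w, ⟨hwne, c, x, hw⟩, hmax⟩ :=
    Set.Finite.exists_maximalFor' List.length closedTrails hfinite hnonempty
  refine ⟨x, w, ⟨hwne, hw.altWalk.isWalkFrom, hw.nodup, hw.altWalk.isCyclicallyAlternating⟩, ?_⟩
  by_contra! hv
  obtain ⟨v, hv, hvw⟩ := hv
  have hxw : x ∈ w.map Prod.snd := hw.altWalk.right_mem_map_snd hwne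
  obtain ⟨e, he, u, hu, u', hu', hl⟩ := (hconn x hw.altWalk.left_mem v hv).exists_isLink_leaving
    (S := {z | z ∈ w.map Prod.snd}) hxw hvw
  have hew : e ∉ walkEdges w := fun h =>
    hu' ((hw.altWalk.eq_or_mem_of_inc h hl.inc_right).elim (fun h => h ▸ hxw) id)
  obtain ⟨d, w', hw', hlt⟩ := hF.exists_longer_isTrailIn hw hu he hew hl.inc_left
  have hw'ne : w' ≠ [] := List.ne_nil_of_length_pos (Nat.zero_lt_of_lt hlt)
  exact hlt.not_ge (hmax ⟨hw'ne, d, u, hw'⟩ hlt.le)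

end IsBalancedCover

lemma exists_isBalancedCover_of_isSupereulerian [G.Loopless] (h : G.IsSupereulerian φ) :
    ∃ F, IsBalancedCover G φ F := by
  classical
  obtain ⟨x, w, htrail, hspan⟩ := h
  obtain ⟨c, hw⟩ := exists_altWalk_of_isClosedAlternatingTrail htrail
  refine ⟨(walkEdges w).toFinset, fun e he => hw.edge_mem (List.mem_toFinset.1 he), fun v => ?_,
    fun v hv => ?_⟩
  · rw [hw.bal_walkEdges htrail.2.2.1, sub_self]
  · obtain ⟨e, he, hi⟩ := hw.exists_mem_walkEdges_inc (hspan v hv)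
    exact ⟨e, List.mem_toFinset.2 he, hi⟩

lemma exists_isBalancedCover_of_hasEulerianFactor [G.Loopless] (h : G.HasEulerianFactor φ) :
    ∃ F, IsBalancedCover G φ F := by
  classical
  obtain ⟨k, W, hdisj, hcov, hW⟩ := h
  have hle (i : Fin k) : G.induce (W i) ≤ G := Graph.induce_le (hcov ▸ Set.subset_iUnion W i)
  have hloopless (i : Fin k) : (G.induce (W i)).Loopless := Graph.Loopless.anti (hle i)
  choose F hF using fun i => exists_isBalancedCover_of_isSupereulerian (hW i)
  have hdisjF : (Set.univ : Set (Fin k)).PairwiseDisjoint F := by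
    intro i _ j _ hij
    refine Finset.disjoint_left.2 fun e hei hej => ?_
    obtain ⟨a, b, hl, ha, -⟩ := (hF i).mem_edgeSet e hei
    obtain ⟨a', b', hl', ha', hb'⟩ := (hF j).mem_edgeSet e hej
    rcases hl.left_eq_or_eq hl' with rfl | rfl
    · exact Set.disjoint_left.1 (hdisj hij) ha ha'
    · exact Set.disjoint_left.1 (hdisj hij) ha hb'
  refine ⟨Finset.univ.biUnion F, fun e he => ?_, fun v => ?_, fun v hv => ?_⟩
  · obtain ⟨i, -, he⟩ := Finset.mem_biUnion.1 he
    exact (hle i).edgeSet_mono ((hF i).mem_edgeSet e he)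
  · rw [bal, Finset.sum_biUnion (by simpa using hdisjF)]
    exact Finset.sum_eq_zero fun i _ =>
      (bal_of_le (hle i) (hF i).mem_edgeSet v).symm.trans ((hF i).bal_eq_zero v)
  · rw [← hcov] at hv
    obtain ⟨i, hi⟩ := Set.mem_iUnion.1 hv
    obtain ⟨e, he, hinc⟩ := (hF i).exists_inc v hi
    exact ⟨e, Finset.mem_biUnion.2 ⟨i, Finset.mem_univ i, he⟩, hinc.mono (hle i)⟩

/-! ### Covers with maximal components -/

/-- A balanced cover whose components cannot be enlarged, that is, one whose connectedness relation
is maximal among the balanced covers. -/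
def IsMaxCover (G : Graph α β) (φ : β → Fin 2) (F : Finset β) : Prop :=
  MaximalFor (IsBalancedCover G φ) (Conn G) F

lemma IsBalancedCover.exists_isMaxCover (hF : IsBalancedCover G φ F) : ∃ F, IsMaxCover G φ F := by
  let pairs : Finset β → Set (α × α) := fun F => {p ∈ V(G) ×ˢ V(G) | Conn G F p.1 p.2}
  have hfinite : (pairs '' {F | IsBalancedCover G φ F}).Finite := by
    refine (hF.finite_vertexSet.prod hF.finite_vertexSet).finite_subsets.subset ?_
    rintro _ ⟨F, -, rfl⟩
    exact fun p hp => hp.1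
  obtain ⟨F, hF, hmax⟩ := Set.Finite.exists_maximalFor' pairs _ hfinite ⟨F, hF⟩
  refine ⟨F, hF, fun F' hF' hle x y hxy => ?_⟩
  rcases hxy.eq_or_mem with rfl | hmem
  · exact .refl _
  · have hsub : pairs F' ⊆ pairs F := hmax hF' fun p hp => ⟨hp.1, hle _ _ hp.2⟩
    exact (hsub (show (x, y) ∈ pairs F' from ⟨hmem, hxy⟩)).2

open scoped Classical in
lemma AltWalk.conn_sdiff {R : Finset β} (h : AltWalk G φ c x w y d) (hw : ∀ e ∈ walkEdges w, e ∈ F)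
    (hR : ∀ e ∈ walkEdges w, ∀ v, G.Inc e v → Conn G F x v → e ∉ R) : Conn G (F \ R) x y := by
  induction h with
  | nil => exact .refl _
  | @cons _ _ e x _ z _ hl _ _ ih =>
    rw [walkEdges_cons, List.forall_mem_cons] at hw hR
    have hxz : Conn G (F \ R) x z :=
      .of_isLink (Finset.mem_sdiff.2 ⟨hw.1, hR.1 x hl.inc_left (.refl x)⟩) hl
    exact hxz.trans <| ih hw.2 fun f hf v hi hv =>
      hR.2 f hf v hi ((Conn.of_isLink hw.1 hl).trans hv)

open scoped Classical in
lemma IsBalancedCover.conn_sdiff [G.Loopless] {R : Finset β} (hF : IsBalancedCover G φ F)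
    (hR : R ⊆ F)
    (hpair : (R : Set β).Pairwise fun e f => ∀ x y, G.Inc e x → G.Inc f y → ¬Conn G F x y)
    (he : e ∈ R) (hl : G.IsLink e x y) : Conn G (F \ R) x y := by
  -- The other edges of a closed trail through `e` are not in `R`, since they are in its component.
  obtain ⟨w, hw⟩ := exists_isTrailIn_sdiff_singleton hF.bal_eq_zero (hR he) hl
  refine (hw.altWalk.conn_sdiff (fun f hf => (Finset.mem_sdiff.1 (hw.mem f hf)).1)
    fun f hf v hi hv hfR => ?_).symm
  have hfe : f ≠ e := by simpa using (Finset.mem_sdiff.1 (hw.mem f hf)).2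
  exact hpair he hfR hfe.symm y v hl.inc_right hi hv

namespace IsMaxCover

lemma conn_of_exchange [G.Loopless] {R : Finset β} (h : IsMaxCover G φ F) (hR : R ⊆ F)
    (hpair : (R : Set β).Pairwise fun e f => ∀ x y, G.Inc e x → G.Inc f y → ¬Conn G F x y)
    (hdisj : Disjoint F A) (hA : ∀ e ∈ A, e ∈ E(G)) (hbal : ∀ v, bal G φ A v = bal G φ R v)
    (he : e ∈ A) (hl : G.IsLink e x y) : Conn G F x y := by
  classical
  have hle : Conn G F ≤ Conn G (F \ R ∪ A) := fun x y hxy => by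
    refine hxy.of_forall_isLink fun e he u v hl => ?_
    by_cases heR : e ∈ R
    · exact (h.1.conn_sdiff hR hpair heR hl).of_forall_isLink fun f hf _ _ hl =>
        .of_isLink (Finset.mem_union_left _ hf) hl
    · exact .of_isLink (by simp [he, heR]) hl
  refine h.2 (j := F \ R ∪ A) ⟨fun e he => ?_, fun v => ?_, fun v hv => ?_⟩ hle x y
    (.of_isLink (Finset.mem_union_right _ he) hl)
  · rcases Finset.mem_union.1 he with he | he
    exacts [h.1.mem_edgeSet e (Finset.mem_sdiff.1 he).1, hA e he]
  · rw [bal_union_of_disjoint (hdisj.mono_left Finset.sdiff_subset), bal_sdiff hR,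
      h.1.bal_eq_zero, hbal, zero_sub, neg_add_cancel]
  · obtain ⟨e, he, v', hl⟩ := h.1.exists_inc v hv
    obtain ⟨f, hf, u, rfl, _, -, hl'⟩ :=
      (hle _ _ (.of_isLink he hl)).exists_isLink_leaving (S := {v}) rfl hl.ne.symm
    exact ⟨f, hf, hl'.inc_left⟩

end IsMaxCover

/-! ### Crossing edges -/

/-- The vertices `x` and `y` are joined by an edge of colour `c`. -/
def ColAdj (G : Graph α β) (φ : β → Fin 2) (c : Fin 2) (x y : α) : Prop :=
  ∃ e, G.IsLink e x y ∧ φ e = c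

lemma ColAdj.symm (h : ColAdj G φ c x y) : ColAdj G φ c y x :=
  h.imp fun _ => .imp_left IsLink.symm

/-- The vertices `x` and `y` are in different components of `F` and joined by an edge of
colour `c`. -/
def CrossAdj (G : Graph α β) (φ : β → Fin 2) (F : Finset β) (c : Fin 2) (x y : α) : Prop :=
  ¬Conn G F x y ∧ ColAdj G φ c x y

namespace CrossAdj

lemma symm (h : CrossAdj G φ F c x y) : CrossAdj G φ F c y x :=
  ⟨fun hyx => h.1 hyx.symm, h.2.symm⟩

lemma left_mem (h : CrossAdj G φ F c x y) : x ∈ V(G) :=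
  h.2.choose_spec.1.left_mem

lemma ne (h : CrossAdj G φ F c x y) : x ≠ y := by
  rintro rfl
  exact h.1 (.refl x)

end CrossAdj

/-- An alternating walk of crossing edges, given by the list `vs` of its vertices after the first
one; the colours `c` and `d` are as in `AltWalk`. -/
inductive CrossWalk (G : Graph α β) (φ : β → Fin 2) (F : Finset β) :
    Fin 2 → α → List α → α → Fin 2 → Prop
  | nil {c : Fin 2} {x : α} (hx : x ∈ V(G)) : CrossWalk G φ F c x [] x c
  | cons {c d : Fin 2} {x y z : α} {vs : List α} (hxz : CrossAdj G φ F c x z)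
      (hvs : CrossWalk G φ F (c + 1) z vs y d) : CrossWalk G φ F c x (z :: vs) y d

lemma CrossWalk.cons_cons {vs : List α} (hxy : CrossAdj G φ F c x y)
    (hyz : CrossAdj G φ F (c + 1) y z) (hvs : CrossWalk G φ F c z vs v d) :
    CrossWalk G φ F c x (y :: z :: vs) v d :=
  .cons hxy (.cons hyz ((colour_add_one_add_one c).symm ▸ hvs))

lemma CrossWalk.exists_altWalk {vs : List α} (h : CrossWalk G φ F c x vs y d) :
    ∃ w, AltWalk G φ c x w y d ∧ w.map Prod.snd = vs ∧
      ∀ e ∈ walkEdges w, ∀ a b, G.IsLink e a b → ¬Conn G F a b := by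
  induction h with
  | nil hx => exact ⟨[], .nil hx, rfl, by simp⟩
  | cons hxz _ ih =>
    obtain ⟨hconn, e, hl, he⟩ := hxz
    obtain ⟨w, hw, rfl, hcross⟩ := ih
    refine ⟨_, .cons hl he hw, rfl, List.forall_mem_cons.2 ⟨fun a b hab => ?_, hcross⟩⟩
    rcases hl.eq_and_eq_or_eq_and_eq hab with ⟨rfl, rfl⟩ | ⟨rfl, rfl⟩
    exacts [hconn, fun hab => hconn hab.symm]

lemma AltWalk.colour_of_inc_left (h : AltWalk G φ c x w y d) (hx : x ∉ w.map Prod.snd)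
    (he : e ∈ walkEdges w) (hi : G.Inc e x) : φ e = c := by
  cases h with
  | nil => simp at he
  | cons hl hc hw =>
    rcases List.mem_cons.1 he with rfl | he
    · exact hc
    · exact absurd (List.mem_cons.2 (hw.eq_or_mem_of_inc he hi)) hx

lemma AltWalk.nodup_walkEdges (h : AltWalk G φ c x w y d) (hw : (w.map Prod.snd).Nodup) :
    (walkEdges w).Nodup := by
  induction h with
  | nil => exact List.nodup_nil
  | cons hl hc htail ih =>
    rw [List.map_cons, List.nodup_cons] at hw
    refine List.nodup_cons.2 ⟨fun he => ?_, ih hw.2⟩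
    exact colour_add_one_ne _ ((htail.colour_of_inc_left hw.1 he hl.inc_right).symm.trans hc)

namespace IsMaxCover

lemma conn_of_closed_altWalk [G.Loopless] (h : IsMaxCover G φ F) (hw : AltWalk G φ c u w u c)
    (hnodup : (walkEdges w).Nodup) (hwF : ∀ e ∈ walkEdges w, e ∉ F) (he : e ∈ walkEdges w)
    (hl : G.IsLink e x y) : Conn G F x y := by
  classical
  refine h.conn_of_exchange (R := ∅) (A := (walkEdges w).toFinset) (Finset.empty_subset F)
    (by simp) (Finset.disjoint_right.2 fun e he => hwF e (List.mem_toFinset.1 he))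
    (fun e he => hw.edge_mem (List.mem_toFinset.1 he)) (fun v => ?_) (List.mem_toFinset.2 he) hl
  rw [hw.bal_walkEdges hnodup, sub_self, bal, Finset.sum_empty]

lemma not_crossWalk [G.Loopless] {vs : List α} (h : IsMaxCover G φ F) (hvs : vs.Nodup)
    (hne : vs ≠ []) : ¬CrossWalk G φ F c x vs x c := by
  intro hwalk
  obtain ⟨w, hw, rfl, hcross⟩ := hwalk.exists_altWalk
  cases hw with
  | nil => exact hne rfl
  | cons hl hc htail =>
    refine hcross _ List.mem_cons_self _ _ hl (h.conn_of_closed_altWalk (.cons hl hc htail)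
      (AltWalk.nodup_walkEdges (.cons hl hc htail) hvs) (fun e he heF => ?_) List.mem_cons_self hl)
    obtain ⟨a, b, hab⟩ := Graph.exists_isLink_of_mem_edgeSet (h.1.mem_edgeSet e heF)
    exact hcross e he a b hab (.of_isLink heF hab)

lemma ne_of_crossAdj [G.Loopless] (h : IsMaxCover G φ F) (hxy : CrossAdj G φ F c x y)
    (hyz : CrossAdj G φ F (c + 1) y z) : x ≠ z := by
  rintro rfl
  exact h.not_crossWalk (by simpa using hxy.ne.symm) (List.cons_ne_nil _ _)
    (.cons_cons hxy hyz (.nil hxy.left_mem))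

lemma not_four_cycle [G.Loopless] (h : IsMaxCover G φ F) {v₁ v₂ v₃ v₄ : α}
    (h₁₂ : CrossAdj G φ F c v₁ v₂) (h₂₃ : CrossAdj G φ F (c + 1) v₂ v₃)
    (h₃₄ : CrossAdj G φ F c v₃ v₄) : ¬CrossAdj G φ F (c + 1) v₄ v₁ := by
  intro h₄₁
  have h₁₃ := h.ne_of_crossAdj h₁₂ h₂₃
  have h₂₄ := h.ne_of_crossAdj h₁₂.symm h₄₁.symm
  refine h.not_crossWalk ?_ (List.cons_ne_nil _ _)
    (.cons_cons h₁₂ h₂₃ (.cons_cons h₃₄ h₄₁ (.nil h₁₂.left_mem)))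
  simp [h₂₃.ne, h₂₄, h₁₂.ne.symm, h₃₄.ne, h₁₃.symm, h₄₁.ne]

lemma not_six_cycle [G.Loopless] (h : IsMaxCover G φ F) {v₁ v₂ v₃ v₄ v₅ v₆ : α}
    (h₁₂ : CrossAdj G φ F c v₁ v₂) (h₂₃ : CrossAdj G φ F (c + 1) v₂ v₃)
    (h₃₄ : CrossAdj G φ F c v₃ v₄) (h₄₅ : CrossAdj G φ F (c + 1) v₄ v₅)
    (h₅₆ : CrossAdj G φ F c v₅ v₆) (h₁₄ : v₁ ≠ v₄) (h₂₅ : v₂ ≠ v₅) (h₃₆ : v₃ ≠ v₆) :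
    ¬CrossAdj G φ F (c + 1) v₆ v₁ := by
  intro h₆₁
  have h₁₃ := h.ne_of_crossAdj h₁₂ h₂₃
  have h₃₅ := h.ne_of_crossAdj h₃₄ h₄₅
  have h₅₁ := h.ne_of_crossAdj h₅₆ h₆₁
  have h₂₄ := h.ne_of_crossAdj h₃₄.symm h₂₃.symm
  have h₄₆ := h.ne_of_crossAdj h₅₆.symm h₄₅.symm
  have h₆₂ := h.ne_of_crossAdj h₁₂.symm h₆₁.symm
  refine h.not_crossWalk ?_ (List.cons_ne_nil _ _)
    (.cons_cons h₁₂ h₂₃ (.cons_cons h₃₄ h₄₅ (.cons_cons h₅₆ h₆₁ (.nil h₁₂.left_mem))))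
  simp [h₂₃.ne, h₂₄.symm, h₂₅, h₆₂, h₁₂.ne.symm, h₃₄.ne, h₃₅, h₃₆, h₁₃.symm, h₄₅.ne, h₄₆.symm,
    h₁₄.symm, h₅₆.ne, h₅₁, h₆₁.ne]

end IsMaxCover

/-! ### Exchanges along two components -/

lemma Conn.of_inc (he : e ∈ F) (hl : G.IsLink e x y) (hi : G.Inc e v) : Conn G F x v := by
  rcases hi.eq_or_eq_of_isLink hl with rfl | rfl
  exacts [.refl _, .of_isLink he hl]

lemma ne_of_isLink_of_not_conn {a b : β} (hxy : ¬Conn G F x y) (hx : x ≠ x') (hf : f ∈ F)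
    (hy : G.IsLink f y y') (ha : G.IsLink a x y) (hb : G.IsLink b x' y') : a ≠ b := by
  rintro rfl
  rcases ha.eq_and_eq_or_eq_and_eq hb with ⟨rfl, -⟩ | ⟨rfl, -⟩
  exacts [hx rfl, hxy (.of_isLink hf hy.symm)]

open scoped Classical in
lemma bal_pair (hef : e ≠ f) (v : α) :
    bal G φ {e, f} v = sgn (φ e) * incInd G e v + sgn (φ f) * incInd G f v :=
  Finset.sum_pair hef

namespace IsMaxCover

lemma not_crossAdj_of_isLink_of_isLink [G.Loopless] (h : IsMaxCover G φ F)
    (he : e ∈ F) (hx : G.IsLink e x x') (hec : φ e = c)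
    (hf : f ∈ F) (hy : G.IsLink f y y') (hfc : φ f = c)
    (hxy : CrossAdj G φ F c x y) : ¬CrossAdj G φ F c x' y' := by
  classical
  rintro ⟨hconn', b, hb, hbc⟩
  obtain ⟨hconn, a, ha, hac⟩ := hxy
  have hcomp {p q : α} (hp : G.Inc e p) (hq : G.Inc f q) : ¬Conn G F p q := fun hpq =>
    hconn (((Conn.of_inc he hx hp).trans hpq).trans (Conn.of_inc hf hy hq).symm)
  have hef : e ≠ f := by
    rintro rfl
    exact hcomp hx.inc_left hx.inc_left (.refl x)
  have hab : a ≠ b := ne_of_isLink_of_not_conn hconn hx.ne hf hy ha hb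
  refine hconn (h.conn_of_exchange (R := {e, f}) (A := {a, b}) (by grind) ?_ ?_
    (by grind [IsLink.edge_mem]) (fun v => ?_) (Finset.mem_insert_self a _) ha)
  · rw [Finset.coe_pair, Set.pairwise_pair]
    exact fun _ => ⟨fun p q hp hq => hcomp hp hq, fun p q hp hq hpq => hcomp hq hp hpq.symm⟩
  · simpa [Finset.disjoint_right] using
      And.intro (fun haF => hconn (.of_isLink haF ha)) fun hbF => hconn' (.of_isLink hbF hb)
  · rw [bal_pair hab, bal_pair hef, hac, hbc, hec, hfc, incInd_eq_add ha, incInd_eq_add hb,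
      incInd_eq_add hx, incInd_eq_add hy]
    ring

lemma not_crossAdj_of_isLink_of_notMem [G.Loopless] (h : IsMaxCover G φ F)
    (he : e ∉ F) (hx : G.IsLink e x x') (hec : φ e = c + 1)
    (hf : f ∈ F) (hy : G.IsLink f y y') (hfc : φ f = c)
    (hxy : CrossAdj G φ F c x y) : ¬CrossAdj G φ F c x' y' := by
  classical
  rintro ⟨hconn', b, hb, hbc⟩
  obtain ⟨hconn, a, ha, hac⟩ := hxy
  have hab : a ≠ b := ne_of_isLink_of_not_conn hconn hx.ne hf hy ha hb
  have he' : e ∉ ({a, b} : Finset β) := by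
    simp only [Finset.mem_insert, Finset.mem_singleton]
    rintro (rfl | rfl)
    exacts [colour_add_one_ne c (hec.symm.trans hac), colour_add_one_ne c (hec.symm.trans hbc)]
  refine hconn (h.conn_of_exchange (R := {f}) (A := {e, a, b}) (by simpa using hf) (by simp) ?_
    (by simp [hx.edge_mem, ha.edge_mem, hb.edge_mem]) (fun v => ?_) (by simp) ha)
  · simpa [Finset.disjoint_right] using And.intro he <|
      And.intro (fun haF => hconn (.of_isLink haF ha)) fun hbF => hconn' (.of_isLink hbF hb)
  · rw [bal, Finset.sum_insert he', ← bal, bal_pair hab, bal_singleton, hac, hbc, hec, hfc,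
      sgn_add_one, incInd_eq_add ha, incInd_eq_add hb, incInd_eq_add hx, incInd_eq_add hy]
    ring

end IsMaxCover

/-! ### M-closed graphs up to twins -/

/-- The ends of every monochromatic path of length two are adjacent or twins, that is, have the same
neighbours in each colour. The extensions of M-closed graphs have this property, although they are
not M-closed themselves. -/
def IsMClosedUpToTwins (G : Graph α β) (φ : β → Fin 2) : Prop :=
  ∀ ⦃c : Fin 2⦄ ⦃x y z : α⦄, ColAdj G φ c x y → ColAdj G φ c y z → x ≠ z →
    G.Adj x z ∨ ∀ d v, ColAdj G φ d x v ↔ ColAdj G φ d z v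

lemma IsMClosedUpToTwins.exists_crossAdj [G.Loopless] (hM : IsMClosedUpToTwins G φ)
    (h : IsMaxCover G φ F) (hxy : ColAdj G φ c x y) (hyz : ColAdj G φ c y z)
    (hxz : ¬Conn G F x z) : ∃ d, CrossAdj G φ F d x z := by
  rcases hM hxy hyz (by rintro rfl; exact hxz (.refl x)) with ⟨e, hl⟩ | htwin
  · exact ⟨φ e, hxz, e, hl, rfl⟩
  obtain ⟨a, ha, -⟩ := hxy
  obtain ⟨b, hb, -⟩ := hyz
  obtain ⟨e, he, hec, x', hx⟩ := h.1.exists_isLink ha.left_mem 0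
  obtain ⟨f, hf, hfc, z', hz⟩ := h.1.exists_isLink hb.right_mem 0
  have hxz' : CrossAdj G φ F 0 x z' :=
    ⟨fun hc => hxz (hc.trans (.of_isLink hf hz.symm)), (htwin 0 z').2 ⟨f, hz, hfc⟩⟩
  have hzx' : CrossAdj G φ F 0 x' z :=
    ⟨fun hc => hxz (.trans (.of_isLink he hx) hc), ((htwin 0 x').1 ⟨e, hx, hec⟩).symm⟩
  exact absurd hzx' (h.not_crossAdj_of_isLink_of_isLink he hx hec hf hz.symm hfc hxz')

/-! ### Adjacent components are completely joined -/

open scoped Classical in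
/-- The sign of the colour of the crossing edges between `x` and `y`, and `0` if there are none. -/
noncomputable def crossSign (G : Graph α β) (φ : β → Fin 2) (F : Finset β) (x y : α) : ℤ :=
  if CrossAdj G φ F 0 x y then 1 else if CrossAdj G φ F 1 x y then -1 else 0

lemma neg_one_le_crossSign_and_le_one (x y : α) :
    -1 ≤ crossSign G φ F x y ∧ crossSign G φ F x y ≤ 1 := by
  unfold crossSign
  split_ifs <;> decide

lemma crossSign_ne_zero_iff : crossSign G φ F x y ≠ 0 ↔ ∃ c, CrossAdj G φ F c x y := by
  unfold crossSign
  split_ifs <;> simp_all [Fin.exists_fin_two]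

lemma IsMaxCover.crossSign_eq_sgn_iff [G.Loopless] (h : IsMaxCover G φ F) :
    crossSign G φ F x y = sgn c ↔ CrossAdj G φ F c x y := by
  have hnot : CrossAdj G φ F 0 x y → ¬CrossAdj G φ F 1 x y := fun h₀ h₁ =>
    h.ne_of_crossAdj h₀ h₁.symm rfl
  fin_cases c <;> simp only [sgn, crossSign] <;> grind

/-- The sum of `g u v` over the ends `u` of `e` and `v` of `f` that belong to `S`. -/
noncomputable def blockSum (G : Graph α β) (S : Finset α) (g : α → α → ℤ) (e f : β) : ℤ :=
  ∑ u ∈ S, incInd G e u * ∑ v ∈ S, incInd G f v * g u v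

lemma sum_incInd_mul [G.Loopless] {S : Finset α} (hl : G.IsLink e x y) (hx : x ∈ S) (hy : y ∈ S)
    (k : α → ℤ) : ∑ v ∈ S, incInd G e v * k v = k x + k y := by
  classical
  simp [incInd_eq_add hl, add_mul, Finset.sum_add_distrib, hx, hy]

lemma blockSum_eq [G.Loopless] {S : Finset α} (hS : ∀ v ∈ V(G), v ∈ S) (g : α → α → ℤ)
    (hx : G.IsLink e x x') (hy : G.IsLink f y y') :
    blockSum G S g e f = g x y + g x y' + g x' y + g x' y' := by
  simp only [blockSum, sum_incInd_mul hx (hS _ hx.left_mem) (hS _ hx.right_mem),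
    sum_incInd_mul hy (hS _ hy.left_mem) (hS _ hy.right_mem)]
  ring

lemma sum_sgn_mul_sum_incInd_mul (F : Finset β) (S : Finset α) (k : α → ℤ) :
    ∑ e ∈ F, sgn (φ e) * ∑ v ∈ S, incInd G e v * k v = ∑ v ∈ S, bal G φ F v * k v := by
  simp only [bal, Finset.mul_sum, Finset.sum_mul, mul_assoc]
  exact Finset.sum_comm

lemma sum_sgn_add_sgn_mul_blockSum (hF : ∀ v, bal G φ F v = 0) (S : Finset α) (g : α → α → ℤ) :
    ∑ p ∈ F ×ˢ F, (sgn (φ p.1) + sgn (φ p.2)) * blockSum G S g p.1 p.2 = 0 := by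
  have hleft (f : β) : ∑ e ∈ F, sgn (φ e) * blockSum G S g e f = 0 := by
    simp only [blockSum, sum_sgn_mul_sum_incInd_mul, hF, zero_mul, Finset.sum_const_zero]
  have hright (e : β) : ∑ f ∈ F, sgn (φ f) * blockSum G S g e f = 0 := by
    calc ∑ f ∈ F, sgn (φ f) * blockSum G S g e f
      _ = ∑ u ∈ S, incInd G e u * ∑ f ∈ F, sgn (φ f) * ∑ v ∈ S, incInd G f v * g u v := by
        simp only [blockSum, Finset.mul_sum, mul_left_comm]
        exact Finset.sum_comm
      _ = 0 := by
        simp only [sum_sgn_mul_sum_incInd_mul, hF, zero_mul, Finset.sum_const_zero, mul_zero]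
  simp only [add_mul, Finset.sum_add_distrib]
  rw [Finset.sum_product_right, Finset.sum_product]
  simp only [hleft, hright, Finset.sum_const_zero, add_zero]

namespace IsMaxCover

lemma sgn_mul_crossSign_add_nonpos [G.Loopless] (hM : IsMClosedUpToTwins G φ)
    (h : IsMaxCover G φ F) (he : e ∈ F) (hx : G.IsLink e x x') (hec : φ e = c) (hf : f ∈ F)
    (hy : G.IsLink f y y') (hfc : φ f = c) :
    sgn c * (crossSign G φ F x y + crossSign G φ F x y' + crossSign G φ F x' y +
        crossSign G φ F x' y') ≤ 0 ∧
      (crossSign G φ F x y + crossSign G φ F x y' + crossSign G φ F x' y +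
          crossSign G φ F x' y' = 0 →
        crossSign G φ F x' y' = -crossSign G φ F x y ∧
          (crossSign G φ F x y ≠ 0 → crossSign G φ F x' y ≠ 0)) := by
  have hblock {x x' y y' : α} (hx : G.IsLink e x x') (hy : G.IsLink f y y') :
      ¬(crossSign G φ F x y = sgn c ∧ crossSign G φ F x' y' = sgn c) ∧
        (crossSign G φ F x y = sgn c → crossSign G φ F x' y ≠ 0 ∧ crossSign G φ F x y' ≠ 0) := by
    simp only [h.crossSign_eq_sgn_iff, crossSign_ne_zero_iff, not_and]
    refine ⟨h.not_crossAdj_of_isLink_of_isLink he hx hec hf hy hfc, fun hxy => ⟨?_, ?_⟩⟩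
    · exact hM.exists_crossAdj h ⟨e, hx.symm, hec⟩ hxy.2
        fun hc => hxy.1 (.trans (.of_isLink he hx) hc)
    · exact hM.exists_crossAdj h hxy.2 ⟨f, hy, hfc⟩
        fun hc => hxy.1 (hc.trans (.of_isLink hf hy.symm))
  have h₁ := hblock hx hy
  have h₂ := hblock hx hy.symm
  have h₃ := hblock hx.symm hy
  have h₄ := hblock hx.symm hy.symm
  have := neg_one_le_crossSign_and_le_one (G := G) (φ := φ) (F := F) x y
  have := neg_one_le_crossSign_and_le_one (G := G) (φ := φ) (F := F) x y'
  have := neg_one_le_crossSign_and_le_one (G := G) (φ := φ) (F := F) x' y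
  have := neg_one_le_crossSign_and_le_one (G := G) (φ := φ) (F := F) x' y'
  rcases sgn_eq_one_or_eq_neg_one c with hc | hc <;> rw [hc] at h₁ h₂ h₃ h₄ ⊢ <;> omega

lemma crossSign_add_eq_zero [G.Loopless] (hM : IsMClosedUpToTwins G φ)
    (h : IsMaxCover G φ F) (he : e ∈ F) (hx : G.IsLink e x x') (hf : f ∈ F)
    (hy : G.IsLink f y y') (hef : φ e = φ f) :
    crossSign G φ F x y + crossSign G φ F x y' + crossSign G φ F x' y + crossSign G φ F x' y'
      = 0 := by
  have hS (v : α) (hv : v ∈ V(G)) : v ∈ h.1.finite_vertexSet.toFinset := by simpa using hv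
  have hsum := sum_sgn_add_sgn_mul_blockSum h.1.bal_eq_zero h.1.finite_vertexSet.toFinset
    (crossSign G φ F)
  rw [Finset.sum_eq_zero_iff_of_nonpos] at hsum
  · have hblock := hsum (e, f) (Finset.mk_mem_product he hf)
    rw [blockSum_eq hS _ hx hy, ← hef] at hblock
    refine (mul_eq_zero.1 hblock).resolve_left fun hzero => ?_
    rcases sgn_eq_one_or_eq_neg_one (φ e) with hc | hc <;> simp only [hc] at hzero <;> omega
  · rintro ⟨e, f⟩ hp
    obtain ⟨he, hf⟩ := Finset.mem_product.1 hp
    obtain ⟨x, x', hx⟩ := exists_isLink_of_mem_edgeSet (h.1.mem_edgeSet e he)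
    obtain ⟨y, y', hy⟩ := exists_isLink_of_mem_edgeSet (h.1.mem_edgeSet f hf)
    by_cases hc : φ e = φ f
    · have := (h.sgn_mul_crossSign_add_nonpos hM he hx rfl hf hy hc.symm).1
      rw [blockSum_eq hS _ hx hy, ← hc]
      linarith
    · rw [colour_ne_iff.1 hc, sgn_add_one, add_neg_cancel, zero_mul]

lemma crossAdj_add_one_of_isLink [G.Loopless] (hM : IsMClosedUpToTwins G φ)
    (h : IsMaxCover G φ F) (he : e ∈ F) (hx : G.IsLink e x x') (hf : f ∈ F)
    (hy : G.IsLink f y y') (hef : φ e = φ f) (hxy : CrossAdj G φ F c x y) :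
    CrossAdj G φ F (c + 1) x' y' := by
  have hneg := ((h.sgn_mul_crossSign_add_nonpos hM he hx rfl hf hy hef.symm).2
    (h.crossSign_add_eq_zero hM he hx hf hy hef)).1
  rwa [h.crossSign_eq_sgn_iff.2 hxy, ← sgn_add_one, h.crossSign_eq_sgn_iff] at hneg

lemma exists_crossAdj_of_isLink [G.Loopless] (hM : IsMClosedUpToTwins G φ)
    (h : IsMaxCover G φ F) (he : e ∈ F) (hx : G.IsLink e x x') (hxy : CrossAdj G φ F c x y) :
    ∃ d, CrossAdj G φ F d x' y := by
  obtain ⟨f, hf, hfe, y', hy⟩ := h.1.exists_isLink hxy.symm.left_mem (φ e)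
  have hne := ((h.sgn_mul_crossSign_add_nonpos hM he hx rfl hf hy hfe).2
    (h.crossSign_add_eq_zero hM he hx hf hy hfe.symm)).2
  exact crossSign_ne_zero_iff.1 (hne (crossSign_ne_zero_iff.2 ⟨c, hxy⟩))

lemma exists_crossAdj_of_conn [G.Loopless] (hM : IsMClosedUpToTwins G φ)
    (h : IsMaxCover G φ F) (hx : Conn G F x x') (hy : Conn G F y y')
    (hxy : CrossAdj G φ F c x y) : ∃ d, CrossAdj G φ F d x' y' := by
  have hleft {x x' y : α} (hx : Conn G F x x') (hxy : ∃ c, CrossAdj G φ F c x y) :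
      ∃ d, CrossAdj G φ F d x' y := by
    induction hx with
    | refl => exact hxy
    | tail _ hl ih =>
      obtain ⟨e, he, hl⟩ := hl
      obtain ⟨d, hd⟩ := ih
      exact h.exists_crossAdj_of_isLink hM he hl hd
  obtain ⟨d, hd⟩ := hleft hx ⟨c, hxy⟩
  obtain ⟨d', hd'⟩ := hleft hy ⟨d, hd.symm⟩
  exact ⟨d', hd'.symm⟩

end IsMaxCover

/-! ### Domination between components -/

/-- `x` has crossing edges to all the vertices of the component of `b`, and they have colour `c`. -/
def IsMonoTo (G : Graph α β) (φ : β → Fin 2) (F : Finset β) (c : Fin 2) (x b : α) : Prop :=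
  ∀ y, Conn G F b y → CrossAdj G φ F c x y

/-- The component of `a` dominates the component of `b`: the crossing edges from any given vertex of
the former to the latter have the same colour. -/
def Dom (G : Graph α β) (φ : β → Fin 2) (F : Finset β) (a b : α) : Prop :=
  ∀ x, Conn G F a x → ∃ c, IsMonoTo G φ F c x b

lemma exists_forall_rel_or_exists_forall_not_rel {ι κ : Type*} {r : ι → κ → Prop} {s : Set ι}
    {t : Set κ} (hs : s.Finite) (ht : t.Nonempty)
    (hr : ∀ i ∈ s, ∀ j ∈ t, ∀ i' ∈ s, ∀ j' ∈ t, r i j → r i' j' → r i j' ∨ r i' j) :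
    (∃ i ∈ s, ∀ j ∈ t, r i j) ∨ ∃ j ∈ t, ∀ i ∈ s, ¬r i j := by
  induction s, hs using Set.Finite.induction_on with
  | empty => exact .inr (ht.imp fun j hj => ⟨hj, by simp⟩)
  | @insert i s _ _ ih =>
    rcases ih fun i hi j hj i' hi' j' hj' => hr i (.inr hi) j hj i' (.inr hi') j' hj' with
      ⟨i', hi', hrow⟩ | ⟨j, hj, hcol⟩
    · exact .inl ⟨i', .inr hi', hrow⟩
    by_cases hij : r i j
    · by_contra! hcon
      obtain ⟨j', hj', hij'⟩ := hcon.1 i (.inl rfl)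
      obtain ⟨i', hi' | hi', hij''⟩ := hcon.2 j' hj'
      · exact hij' (hi' ▸ hij'')
      · exact (hr i (.inl rfl) j hj i' (.inr hi') j' hj' hij hij'').elim hij' (hcol i' hi')
    · refine .inr ⟨j, hj, ?_⟩
      rintro i' (rfl | hi')
      exacts [hij, hcol i' hi']

lemma Dom.congr_right {a b b' : α} (hab : Dom G φ F a b) (hb : Conn G F b b') : Dom G φ F a b' :=
  fun x hx => (hab x hx).imp fun _ hc y hy => hc y (hb.trans hy)

lemma Dom.left_mem {a b : α} (hab : Dom G φ F a b) : a ∈ V(G) :=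
  ((hab a (.refl a)).choose_spec b (.refl b)).left_mem

namespace IsMaxCover

variable [G.Loopless] {a b : α}

lemma isMonoTo_add_one (hM : IsMClosedUpToTwins G φ) (h : IsMaxCover G φ F) (he : e ∈ F)
    (hl : G.IsLink e x x') (hx : IsMonoTo G φ F c x b) : IsMonoTo G φ F (c + 1) x' b := by
  intro y hy
  obtain ⟨f, hf, hfe, z, hz⟩ := h.1.exists_isLink (hx y hy).symm.left_mem (φ e)
  exact h.crossAdj_add_one_of_isLink hM he hl hf hz.symm hfe.symm
    (hx z (hy.trans (.of_isLink hf hz)))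

lemma dom_of_isMonoTo (hM : IsMClosedUpToTwins G φ) (h : IsMaxCover G φ F) (hx : Conn G F a x)
    (hmono : IsMonoTo G φ F c x b) : Dom G φ F a b := by
  intro z hz
  have hxz : Conn G F x z := hx.symm.trans hz
  clear hz
  induction hxz with
  | refl => exact ⟨c, hmono⟩
  | tail _ hl ih =>
    obtain ⟨e, he, hl⟩ := hl
    obtain ⟨d, hd⟩ := ih
    exact ⟨d + 1, h.isMonoTo_add_one hM he hl hd⟩

lemma dom_or_dom (hM : IsMClosedUpToTwins G φ) (h : IsMaxCover G φ F)
    (hab : CrossAdj G φ F c a b) : Dom G φ F a b ∨ Dom G φ F b a := by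
  have hone {x y : α} (hx : Conn G F a x) (hy : Conn G F b y) (hxy : ¬CrossAdj G φ F 0 x y) :
      CrossAdj G φ F (0 + 1) x y := by
    obtain ⟨d, hd⟩ := h.exists_crossAdj_of_conn hM hx hy hab
    rwa [colour_ne_iff.1 (show 0 ≠ d by rintro rfl; exact hxy hd)] at hd
  have hfin : {x | Conn G F a x}.Finite :=
    h.1.finite_vertexSet.subset fun x hx => hx.right_mem hab.left_mem
  have hferrers (x) (hx : Conn G F a x) (y) (hy : Conn G F b y) (x') (hx' : Conn G F a x')
      (y') (hy' : Conn G F b y') (hxy : CrossAdj G φ F 0 x y) (hxy' : CrossAdj G φ F 0 x' y') :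
      CrossAdj G φ F 0 x y' ∨ CrossAdj G φ F 0 x' y := by
    by_contra! hcon
    exact h.not_four_cycle hxy (hone hx' hy hcon.2).symm hxy' (hone hx hy' hcon.1).symm
  rcases exists_forall_rel_or_exists_forall_not_rel (t := {y | Conn G F b y}) hfin ⟨b, .refl b⟩
    hferrers with ⟨x, hx, hrow⟩ | ⟨y, hy, hcol⟩
  · exact .inl (h.dom_of_isMonoTo hM hx hrow)
  · exact .inr (h.dom_of_isMonoTo hM hy fun x hx => (hone hx hy (hcol x hx)).symm)

lemma exists_isMonoTo (hM : IsMClosedUpToTwins G φ) (h : IsMaxCover G φ F) (hab : Dom G φ F a b)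
    (c : Fin 2) : ∃ x, Conn G F a x ∧ IsMonoTo G φ F c x b := by
  obtain ⟨d, hd⟩ := hab a (.refl a)
  by_cases hdc : d = c
  · exact ⟨a, .refl a, hdc ▸ hd⟩
  · obtain ⟨e, he, -, x, hl⟩ := h.1.exists_isLink hab.left_mem 0
    exact ⟨x, .of_isLink he hl, colour_ne_iff.1 hdc ▸ h.isMonoTo_add_one hM he hl hd⟩

lemma isMonoTo_of_crossAdj (h : IsMaxCover G φ F) (hab : Dom G φ F a b) (hx : Conn G F a x)
    (hxb : CrossAdj G φ F c x b) : IsMonoTo G φ F c x b := by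
  obtain ⟨d, hd⟩ := hab x hx
  by_cases hcd : c = d
  · exact hcd ▸ hd
  · exact absurd rfl (h.ne_of_crossAdj hxb.symm (colour_ne_iff.1 hcd ▸ hd b (.refl b)))

lemma dom_asymm (hM : IsMClosedUpToTwins G φ) (h : IsMaxCover G φ F) (hab : Dom G φ F a b) :
    ¬Dom G φ F b a := by
  intro hba
  obtain ⟨c, hc⟩ := hba b (.refl b)
  obtain ⟨x, hx, hxb⟩ := h.exists_isMonoTo hM hab (c + 1)
  exact h.ne_of_crossAdj (hc x hx) (hxb b (.refl b)) rfl

lemma not_dom_of_dom_of_dom (hM : IsMClosedUpToTwins G φ) (h : IsMaxCover G φ F) {a₁ a₂ a₃ : α}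
    (h₁₂ : Dom G φ F a₁ a₂) (h₂₃ : Dom G φ F a₂ a₃) : ¬Dom G φ F a₃ a₁ := by
  intro h₃₁
  have hne {b x y : α} (hx : IsMonoTo G φ F 0 x b) (hy : IsMonoTo G φ F (0 + 1) y b) : x ≠ y :=
    h.ne_of_crossAdj (hx b (.refl b)) (hy b (.refl b)).symm
  obtain ⟨x₁, hx₁, hx₁'⟩ := h.exists_isMonoTo hM h₁₂ 0
  obtain ⟨y₁, hy₁, hy₁'⟩ := h.exists_isMonoTo hM h₁₂ (0 + 1)
  obtain ⟨x₂, hx₂, hx₂'⟩ := h.exists_isMonoTo hM h₂₃ 0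
  obtain ⟨y₂, hy₂, hy₂'⟩ := h.exists_isMonoTo hM h₂₃ (0 + 1)
  obtain ⟨x₃, hx₃, hx₃'⟩ := h.exists_isMonoTo hM h₃₁ 0
  obtain ⟨y₃, hy₃, hy₃'⟩ := h.exists_isMonoTo hM h₃₁ (0 + 1)
  exact h.not_six_cycle (hx₁' y₂ hy₂) (hy₂' x₃ hx₃) (hx₃' y₁ hy₁) (hy₁' x₂ hx₂) (hx₂' y₃ hy₃)
    (hne hx₁' hy₁') (hne hx₂' hy₂').symm (hne hx₃' hy₃') (hy₃' x₁ hx₁)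

lemma dom_trans (hM : IsMClosedUpToTwins G φ) (h : IsMaxCover G φ F) (hab : Dom G φ F a x)
    (hbc : Dom G φ F x b) : Dom G φ F a b := by
  have hconn : ¬Conn G F a b := fun hconn =>
    h.dom_asymm hM hab (hbc.congr_right hconn.symm)
  obtain ⟨c, hc⟩ := hab a (.refl a)
  obtain ⟨y, hy, hyb⟩ := h.exists_isMonoTo hM hbc c
  obtain ⟨d, hd⟩ := hM.exists_crossAdj h (hc y hy).2 (hyb b (.refl b)).2 hconn
  exact (h.dom_or_dom hM hd).resolve_right (h.not_dom_of_dom_of_dom hM hab hbc)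

lemma exists_forall_not_dom (hne : V(G).Nonempty) (hM : IsMClosedUpToTwins G φ)
    (h : IsMaxCover G φ F) : ∃ a ∈ V(G), ∀ b, ¬Dom G φ F b a := by
  have : Finite V(G) := h.1.finite_vertexSet
  let r : V(G) → V(G) → Prop := fun p q => Dom G φ F p q
  have : IsTrans V(G) r := ⟨fun _ _ _ => h.dom_trans hM⟩
  have : Std.Irrefl r := ⟨fun _ hp => h.dom_asymm hM hp hp⟩
  obtain ⟨a, -, ha⟩ := (Finite.wellFounded_of_trans_of_irrefl r).has_min Set.univ
    ⟨⟨_, hne.some_mem⟩, trivial⟩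
  exact ⟨a, a.2, fun b hb => ha ⟨b, hb.left_mem⟩ trivial hb⟩

end IsMaxCover

/-! ### Undominated components -/

namespace IsMaxCover

variable [G.Loopless] {a b : α}

lemma not_crossAdj_add_one_of_crossAdj (hM : IsMClosedUpToTwins G φ) (h : IsMaxCover G φ F)
    (ha : ∀ b, ¬Dom G φ F b a) (hy : CrossAdj G φ F c a y) : ¬CrossAdj G φ F (c + 1) a z := by
  intro hz
  have hay := h.isMonoTo_of_crossAdj ((h.dom_or_dom hM hy).resolve_right (ha y)) (.refl a) hy
  have haz := h.isMonoTo_of_crossAdj ((h.dom_or_dom hM hz).resolve_right (ha z)) (.refl a) hz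
  obtain ⟨e, he, -, x, hl⟩ := h.1.exists_isLink hy.left_mem 0
  have hxy := h.isMonoTo_add_one hM he hl hay y (.refl y)
  have hxz := h.isMonoTo_add_one hM he hl haz z (.refl z)
  rw [colour_add_one_add_one] at hxz
  exact h.not_four_cycle hy.symm hz hxz.symm hxy

lemma crossAdj_of_isLink (hM : IsMClosedUpToTwins G φ) (h : IsMaxCover G φ F)
    (ha : ∀ b, ¬Dom G φ F b a) (hx : Conn G F a x) (hx' : Conn G F a x') (hl : G.IsLink e x x')
    (hec : φ e = c) (hz : CrossAdj G φ F (c + 1) x z) : CrossAdj G φ F c x' z := by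
  obtain ⟨k, haz⟩ := h.exists_crossAdj_of_conn hM hx.symm (.refl z) hz
  have hdom : Dom G φ F a z := (h.dom_or_dom hM haz).resolve_right (ha z)
  by_cases he : e ∈ F
  · have := h.isMonoTo_add_one hM he hl (h.isMonoTo_of_crossAdj hdom hx hz) z (.refl z)
    rwa [colour_add_one_add_one] at this
  obtain ⟨d, hd⟩ := hdom x' hx'
  by_cases hcd : c = d
  · exact hcd ▸ hd z (.refl z)
  obtain ⟨f, hf, hfc, z', hzz'⟩ := h.1.exists_isLink hz.symm.left_mem (c + 1)
  refine absurd (hd z' (.of_isLink hf hzz')) ?_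
  rw [colour_ne_iff.1 hcd]
  exact h.not_crossAdj_of_isLink_of_notMem he hl (by rw [hec, colour_add_one_add_one]) hf hzz' hfc
    hz

lemma exists_crossAdj_of_altWalk (hM : IsMClosedUpToTwins G φ) (h : IsMaxCover G φ F)
    (ha : ∀ b, ¬Dom G φ F b a) (hw : AltWalk G φ c x w y d)
    (hx : Conn G F a x → ∃ z, CrossAdj G φ F (c + 1) x z) (hy : Conn G F a y) :
    ∃ z, CrossAdj G φ F (d + 1) y z := by
  induction hw with
  | nil => exact hx hy
  | @cons c _ e x _ x' _ hl hec _ ih =>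
    refine ih (fun hx' => ?_) hy
    rw [colour_add_one_add_one]
    by_cases hax : Conn G F a x
    · exact (hx hax).imp fun z hz => h.crossAdj_of_isLink hM ha hax hx' hl hec hz
    · exact ⟨x, fun hc => hax (hx'.trans hc), e, hl.symm, hec⟩

lemma conn_of_isTrailColourConnected (hM : IsMClosedUpToTwins G φ) (h : IsMaxCover G φ F)
    (hT : G.IsTrailColourConnected φ) (hx : x ∈ V(G)) (hy : y ∈ V(G)) : Conn G F x y := by
  obtain ⟨a, haV, ha⟩ := h.exists_forall_not_dom ⟨x, hx⟩ hM
  have hconn (v : α) (hv : v ∈ V(G)) : Conn G F a v := by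
    by_contra hav
    have hva : v ≠ a := by
      rintro rfl
      exact hav (.refl v)
    obtain ⟨c, c', d, w, w', hw, hw'⟩ := exists_altWalk_pair_of_isTrailColourConnected hT hv haV hva
    obtain ⟨z, hz⟩ := h.exists_crossAdj_of_altWalk hM ha hw (fun hc => absurd hc hav) (.refl a)
    obtain ⟨z', hz'⟩ := h.exists_crossAdj_of_altWalk hM ha hw' (fun hc => absurd hc hav) (.refl a)
    exact h.not_crossAdj_add_one_of_crossAdj hM ha hz hz'
  exact (hconn x hx).symm.trans (hconn y hy)

end IsMaxCover

/-! ### Extensions -/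

lemma loopless_extension (hloop : G.Loopless) (p : α → ℕ) : (G.extension p).Loopless :=
  ⟨fun d a h => hloop.not_isLoopAt d.1 a.1 h.1⟩

lemma colAdj_extension_iff {p : α → ℕ} {a b : α × ℕ} :
    ColAdj (G.extension p) (extensionColour φ) c a b ↔
      ColAdj G φ c a.1 b.1 ∧ a.2 < p a.1 ∧ b.2 < p b.1 := by
  constructor
  · rintro ⟨d, ⟨hl, ha, hb, -⟩, hc⟩
    exact ⟨⟨d.1, hl, hc⟩, ha, hb⟩
  · rintro ⟨⟨e, hl, hc⟩, ha, hb⟩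
    exact ⟨(e, s(a, b)), ⟨hl, ha, hb, rfl⟩, hc⟩

lemma isMClosedUpToTwins_extension (hM : G.IsMClosed φ) (p : α → ℕ) :
    IsMClosedUpToTwins (G.extension p) (extensionColour φ) := by
  intro c a b a' hab hba' _
  rw [colAdj_extension_iff] at hab hba'
  obtain ⟨⟨e, he, hec⟩, ha, -⟩ := hab
  obtain ⟨⟨f, hf, hfc⟩, -, ha'⟩ := hba'
  by_cases haa' : a.1 = a'.1
  · refine .inr fun d v => ?_
    rw [haa'] at ha
    simp only [colAdj_extension_iff, ha, ha', haa']
  · obtain ⟨g, hg⟩ := hM he hf haa' (hec.trans hfc.symm)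
    exact .inl ⟨(g, s(a, a')), hg, ha, ha', rfl⟩

end EdgeColouredGraph

theorem mainTheorem1_general {α β : Type*} (G : Graph α β) (φ : β → Fin 2) [G.Loopless]
    (hne : V(G).Nonempty) (hM : EdgeColouredGraph.IsMClosedUpToTwins G φ) :
    G.IsSupereulerian φ ↔ G.IsTrailColourConnected φ ∧ G.HasEulerianFactor φ := by
  constructor
  · exact fun h => ⟨EdgeColouredGraph.isTrailColourConnected_of_isSupereulerian h,
      EdgeColouredGraph.hasEulerianFactor_of_isSupereulerian h⟩
  · rintro ⟨hT, hfactor⟩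
    obtain ⟨F₀, hF₀⟩ := EdgeColouredGraph.exists_isBalancedCover_of_hasEulerianFactor hfactor
    obtain ⟨F, hF⟩ := hF₀.exists_isMaxCover
    exact hF.1.isSupereulerian hne fun u hu v hv => hF.conn_of_isTrailColourConnected hM hT hu hv

theorem mainTheorem1 {α β : Type*} (G : Graph α β) (φ : β → Fin 2)
    (hV : V(G).Finite) (hE : E(G).Finite) (hloop : G.Loopless) (hn : V(G).Nontrivial)
    (hM : G.IsMClosed φ)
    (p : α → ℕ) (hp : ∀ v ∈ V(G), 1 ≤ p v) :
    (G.extension p).IsSupereulerian (Graph.extensionColour φ) ↔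
      (G.extension p).IsTrailColourConnected (Graph.extensionColour φ) ∧
        (G.extension p).HasEulerianFactor (Graph.extensionColour φ) := by
  have := EdgeColouredGraph.loopless_extension hloop p
  obtain ⟨x, hx⟩ := hn.nonempty
  exact mainTheorem1_general _ _ ⟨(x, 0), hx, hp x hx⟩
    (EdgeColouredGraph.isMClosedUpToTwins_extension hM p)
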